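/- Let $\mathcal C=\mathbb T\times[0,1]\subset\mathbb C^2$ be the round cylinder, with points $(z,t)$, $z=e^{i\phi}$, and let $$\mathcal R(z,t)=\left(\frac{z^2+t^2}{z^{-2}+t^2},\ \frac{z^2+z^{-2}+2}{z^2+z^{-2}+t^2+t^{-2}}\right)$$ (extended to $t=0$ by clearing denominators) be the Migdal–Kadanoff renormalization transformation of the diamond hierarchical lattice. It maps $\mathcal C\smallsetminus\{\alpha_\pm\}$ into $\mathcal C$, where $\alpha_\pm=(\pm i,1)$ are its indeterminacy points. Put $\tau=1-t$ and $\epsilon=\pi/2-\phi \bmod \pi\mathbb Z$, with $|\epsilon|$ the distance from $\pi/2-\phi$ to $\pi\mathbb Z$. The algebraic horizontal cone $\mathcal K^{ah}(x)$ is the open cone in $T_x\mathcal C$ bounded by the tangent lines to the two rotated copies of the curve $t=-\cos\phi$ passing through $x$; these lines have slopes $dt/d\phi=\pm s^a(x)$, $s^a=\sqrt{\tau(2-\tau)}$. For $\bar\epsilon>0$ put $\bar\tau=\bar\epsilon^2/18$ and $$\mathcal V=\{x\in\mathcal C:\tau\le\bar\tau\},\quad \mathcal V'=\{x\in\mathcal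 V:\tau\le\epsilon^2/18\},\quad \mathcal U=\{x\in\mathcal V:|\epsilon|<\bar\epsilon\},\quad \mathcal U'=\mathcal U\cap\mathcal V'.$$ A modified horizontal cone field with threshold $\bar\epsilon$ is a field of open cones $\mathcal K^h(x)=\{v\in T_x\mathcal C:\ |dt(v)|<s(x)\,|d\phi(v)|\}$, where $s:\mathcal C\to\mathbb R$ is continuous on $\mathcal C\smallsetminus\{\alpha_\pm\}$ and (o) $s\ge s^a$ everywhere; (i) $s=s^a$ on $\mathcal C\smallsetminus\mathcal V'$; (ii) $s\sim|\epsilon|/3$ on $\mathcal U'$, meaning $\bigl|s-|\epsilon|/3\bigr|\le\delta(|\epsilon|)\,|\epsilon|$ there, for a function $\delta$, fixed in advance and independent of $\bar\epsilon$, with $\delta(r)\to0$ as $r\to0^+$; (iii) $s=\sqrt{\bar\tau(2-\bar\tau)}$ on $\mathcal V\smallsetminus\mathcal U$. **Theorem.** For every such function $\delta$ there is $\epsilon_0>0$ such that for every $0<\bar\epsilon<\epsilon_0$ and every modified horizontal cone field $\mathcal K^h$ with threshold $\bar\epsilon$, the map $\mathcal R|\mathcal C$ is horizontally expanding with rate $\lambda=2$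 with respect to $\mathcal K^h$. That is: * $\mathcal K^h$ is forward invariant: $D\mathcal R(x)\,\mathcal K^h(x)\subset\mathcal K^h(\mathcal R x)$ whenever $x\in\mathcal C\smallsetminus\{\alpha_\pm\}$ and $\mathcal R x\notin\{\alpha_\pm\}$; * there is $c>0$ such that $$\|D\mathcal R^n(x)\,v\|\ \ge\ c\,2^n\,\|v\|$$ for every $x\in\mathcal C\smallsetminus\{\alpha_\pm\}$, every $n=0,1,2,\dots$ for which $D\mathcal R^n(x)$ is defined (i.e. $\mathcal R^kx\notin\{\alpha_\pm\}$ for $0\le k<n$), and every $v\in\mathcal K^h(x)$, where $\|\cdot\|$ is the Euclidean norm. -/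

import Mathlib

open Filter Topology

noncomputable section

namespace DHL

/-- The renormalization transformation of the diamond hierarchical lattice, as a rational map in the
physical coordinates `(z, t)`, with denominators cleared of the negative powers of `z` and `t`
(so that the formula is the right one also at `t = 0`). -/
def R (x : ℂ × ℂ) : ℂ × ℂ :=
  (x.1 ^ 2 * (x.1 ^ 2 + x.2 ^ 2) / (1 + x.2 ^ 2 * x.1 ^ 2),
    x.2 ^ 2 * (x.1 ^ 2 + 1) ^ 2 / ((x.1 ^ 2 + x.2 ^ 2) * (1 + x.2 ^ 2 * x.1 ^ 2)))

/-- Where `z, t ≠ 0`, the map `R` is given by the usual expression with negative powers. -/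
theorem R_eq (z t : ℂ) (hz : z ≠ 0) (ht : t ≠ 0) :
    R (z, t) = ((z ^ 2 + t ^ 2) / ((z ^ 2)⁻¹ + t ^ 2),
      (z ^ 2 + (z ^ 2)⁻¹ + 2) / (z ^ 2 + (z ^ 2)⁻¹ + t ^ 2 + (t ^ 2)⁻¹)) := by
  have e1 : (z ^ 2)⁻¹ + t ^ 2 = (1 + t ^ 2 * z ^ 2) / z ^ 2 := by field_simp
  have e2 : z ^ 2 + (z ^ 2)⁻¹ + t ^ 2 + (t ^ 2)⁻¹
      = ((z ^ 2 + t ^ 2) * (1 + t ^ 2 * z ^ 2)) / (z ^ 2 * t ^ 2) := by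
    field_simp; ring
  have e3 : z ^ 2 + (z ^ 2)⁻¹ + 2 = (z ^ 2 + 1) ^ 2 / z ^ 2 := by field_simp; ring
  simp only [R]
  rw [e1, e2, e3, div_div_eq_mul_div, div_div_eq_mul_div, div_mul_eq_mul_div]
  refine Prod.ext ?_ ?_
  · simp only; ring
  · simp only
    congr 1
    field_simp

/-- The closed round cylinder `𝕋 × [0, 1]`, sitting in `ℂ²`. -/
def cylinder : Set (ℂ × ℂ) :=
  {x | ‖x.1‖ = 1 ∧ ∃ t : ℝ, 0 ≤ t ∧ t ≤ 1 ∧ x.2 = (t : ℂ)}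

/-- The two indeterminacy points `α_± = (± i, 1)` of `R` on the cylinder. -/
def indet : Set (ℂ × ℂ) := {(Complex.I, 1), (-Complex.I, 1)}

/-- `τ = 1 - t`. -/
def tau (x : ℂ × ℂ) : ℝ := 1 - x.2.re

/-- `|ε|` for `ε = π/2 - φ mod π`, where `z = e^{iφ}`: the norm on `AddCircle π = ℝ / πℤ` is the
distance to the nearest multiple of `π`. -/
def absEps (x : ℂ × ℂ) : ℝ := ‖((Real.pi / 2 - Complex.arg x.1 : ℝ) : AddCircle Real.pi)‖

/-- Absolute value of the slope `dt/dφ` of the two lines that bound the algebraic horizontal cone. -/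
def algSlope (x : ℂ × ℂ) : ℝ := √(tau x * (2 - tau x))

/-- The algebraic cone at a point is bounded by the tangent lines to the leaves through that point
of the two foliations obtained by rotating the principal Lee-Yang locus `t = - cos φ`; their slopes
are `± algSlope`. -/
theorem abs_deriv_leaf (θ φ : ℝ) :
    |deriv (fun ψ : ℝ => -Real.cos (ψ - θ)) φ|
      = algSlope (Complex.exp (φ * Complex.I), ((-Real.cos (φ - θ) : ℝ) : ℂ)) := by
  have h : HasDerivAt (fun ψ : ℝ => -Real.cos (ψ - θ)) (Real.sin (φ - θ)) φ := by
    refine (((hasDerivAt_id φ).sub_const θ).cos.fun_neg).congr_deriv ?_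
    simp
  rw [h.deriv, algSlope, tau, Complex.ofReal_re, ← Real.sqrt_sq_eq_abs]
  congr 1
  nlinarith [Real.sin_sq_add_cos_sq (φ - θ)]

/-- The annular neighborhood `{τ ≤ τ̄}` of the top, with `τ̄ = ε̄² / 18`. -/
def regionV (εb : ℝ) : Set (ℂ × ℂ) := {x ∈ cylinder | tau x ≤ εb ^ 2 / 18}

/-- `regionV` with the two regions below the parabolas `τ = ε² / 18` removed. -/
def regionV' (εb : ℝ) : Set (ℂ × ℂ) := {x ∈ regionV εb | tau x ≤ absEps x ^ 2 / 18}

/-- The part of `regionV` over `|ε| < ε̄`. -/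
def regionU (εb : ℝ) : Set (ℂ × ℂ) := {x ∈ regionV εb | absEps x < εb}

/-- The part of `regionV'` over `|ε| < ε̄`. -/
def regionU' (εb : ℝ) : Set (ℂ × ℂ) := {x ∈ regionV' εb | absEps x < εb}

/-- `s` is the slope function (absolute value of the slope of the boundary lines) of a modified
horizontal cone field with threshold `εb`. The relation `s ∼ |ε| / 3` on `regionU'` is measured
by a modulus `δ`, which is meant to satisfy `δ r → 0` as `r → 0+`. -/
structure IsModifiedSlope (δ : ℝ → ℝ) (εb : ℝ) (s : ℂ × ℂ → ℝ) : Prop where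
  continuousOn : ContinuousOn s (cylinder \ indet)
  alg_le : ∀ x ∈ cylinder, algSlope x ≤ s x
  white : ∀ x ∈ cylinder \ regionV' εb, s x = algSlope x
  grey : ∀ x ∈ regionU' εb, |s x - absEps x / 3| ≤ δ (absEps x) * absEps x
  black : ∀ x ∈ regionV εb \ regionU εb, s x = √(εb ^ 2 / 18 * (2 - εb ^ 2 / 18))

/-- The open horizontal cone of slope `s x` in the tangent space to the cylinder at `x = (z, t)`,
whose vectors are `a ∂_φ + b ∂_t = (a i z, b)` with `a, b` real. -/
def slopeCone (s : ℂ × ℂ → ℝ) (x : ℂ × ℂ) : Set (ℂ × ℂ) :=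
  {v | ∃ a b : ℝ, v = ((a : ℂ) * (Complex.I * x.1), (b : ℂ)) ∧ |b| < s x * |a|}

/-- The Euclidean norm on `ℂ²`. On a tangent vector `a ∂_φ + b ∂_t` of the cylinder it is
`√(a² + b²)`. -/
def euclNorm (v : ℂ × ℂ) : ℝ := √(‖v.1‖ ^ 2 + ‖v.2‖ ^ 2)

/-- `R` on the cylinder is horizontally expanding with rate `lam` with respect to the cone field `K`:
the cone field is forward invariant off the indeterminacy points, and `DRⁿ` stretches the vectors of
the cones by at least `c lamⁿ`, at each point where `DRⁿ` is defined, that is, whose first `n`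
orbit points are not indeterminacy points. -/
def IsHorizontallyExpanding (K : ℂ × ℂ → Set (ℂ × ℂ)) (lam : ℝ) : Prop :=
  1 < lam ∧
  (∀ x ∈ cylinder \ indet, R x ∉ indet → ∀ v ∈ K x, fderiv ℂ R x v ∈ K (R x)) ∧
  ∃ c : ℝ, 0 < c ∧ ∀ x ∈ cylinder \ indet, ∀ n : ℕ, (∀ k < n, R^[k] x ∉ indet) →
    ∀ v ∈ K x, c * lam ^ n * euclNorm v ≤ euclNorm (fderiv ℂ (R^[n]) x v)

end DHL

end

/-!
A tangent vector `a ∂_φ + b ∂_t` of the cylinder at height `t` gets the Lorentz form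
`a² - b² / (1 - t²)`. In the angle `θ = arccos t` it is `dφ² - dθ²`, and the algebraic horizontal
cone is the cone of its positive vectors.

The proof rests on the fact that `R` stretches this form by a factor of at least `4`, on all tangent
vectors (`four_mul_lorentz_le`): up to a positive factor, the difference between the form of the
image vector and four times the form of the vector is a quadratic form in `(a, b)`, with polynomial
coefficients in `t` and `cos φ`, whose discriminant factors, the only factor without an evident sign
being the one of `discriminant_factor_nonneg`. In particular `R` maps the algebraic cone into
itself, and along an orbit the form grows at least like `4ⁿ`, so that `|dφ|`, which dominates its
square root, grows at least like `2ⁿ`.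

The form may be negative, or small compared with `a²`, on a vector of a modified cone. One iterate
repairs this (`one_eighth_le_lorentz`): the image vector has Lorentz form at least `a² / 8`. For the
algebraic cone this is an inequality in the null coordinates `φ ± θ`
(`abs_imageY_le_imageX_of_null`). In the modified part of the cone field both the slope and `1 - t²`
are small, of orders `|cos φ| / 3` and `cos² φ / 9`, which makes the estimate a crude one
(`exists_threshold`). The same positivity puts the image vector inside the algebraic cone, and
therefore inside the modified one, except at the top `t = 1`, where the image vector is horizontal.
-/

namespace DHL

/-! ### The map and its differential in cylindrical coordinates -/

/-- The point `(c + i s, t)`; it lies on the cylinder when `c² + s² = 1` and `0 ≤ t ≤ 1`, and then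
`c = cos φ`, `s = sin φ`. -/
def pt (c s t : ℝ) : ℂ × ℂ := ((c : ℂ) + (s : ℂ) * Complex.I, (t : ℂ))

/-- The tangent vector `a ∂_φ + b ∂_t` at `x`. -/
def tangent (x : ℂ × ℂ) (a b : ℝ) : ℂ × ℂ := ((a : ℂ) * (Complex.I * x.1), (b : ℂ))

/-- `|z² + t²|²`, in terms of `c = Re z`, for `|z| = 1`. -/
def den (c t : ℝ) : ℝ := (1 - t ^ 2) ^ 2 + 4 * t ^ 2 * c ^ 2

/-- The `t`-coordinate of the image under `R`. -/
noncomputable def imageT (c t : ℝ) : ℝ := 4 * t ^ 2 * c ^ 2 / den c t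

/-- The numerator of the `∂_φ`-component of the image of `a ∂_φ + b ∂_t` under the differential
of `R`. -/
def imageX (c s t a b : ℝ) : ℝ := (1 - t ^ 2 + 2 * t ^ 2 * c ^ 2) * a - 2 * t * s * c * b

/-- The numerator of the `∂_t`-component of the image of `a ∂_φ + b ∂_t` under the differential
of `R`, up to the factor `8 t (1 - t²) c`. -/
def imageY (c s t a b : ℝ) : ℝ := -(t * (1 - t ^ 2) * s * a) + (1 + t ^ 2) * c * b

/-- The `∂_φ`-component of the image of `a ∂_φ + b ∂_t` under the differential of `R`. -/
noncomputable def imageA (c s t a b : ℝ) : ℝ := 4 * imageX c s t a b / den c t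

/-- The `∂_t`-component of the image of `a ∂_φ + b ∂_t` under the differential of `R`. -/
noncomputable def imageB (c s t a b : ℝ) : ℝ :=
  8 * t * (1 - t ^ 2) * c * imageY c s t a b / den c t ^ 2

theorem exists_eq_pt {x : ℂ × ℂ} (hx : x ∈ cylinder) :
    ∃ c s t : ℝ, c ^ 2 + s ^ 2 = 1 ∧ 0 ≤ t ∧ t ≤ 1 ∧ x = pt c s t := by
  obtain ⟨hz, t, h0, h1, ht⟩ := hx
  refine ⟨x.1.re, x.1.im, t, ?_, h0, h1, ?_⟩
  · have := Complex.sq_norm x.1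
    rw [hz, Complex.normSq_apply] at this
    linarith
  · exact Prod.ext (Complex.re_add_im x.1).symm ht

@[simp] theorem pt_fst_re (c s t : ℝ) : (pt c s t).1.re = c := by simp [pt]

@[simp] theorem pt_fst_im (c s t : ℝ) : (pt c s t).1.im = s := by simp [pt]

@[simp] theorem pt_snd_re (c s t : ℝ) : (pt c s t).2.re = t := by simp [pt]

theorem pt_mem_cylinder {c s t : ℝ} (h : c ^ 2 + s ^ 2 = 1) (h0 : 0 ≤ t) (h1 : t ≤ 1) :
    pt c s t ∈ cylinder := by
  refine ⟨?_, t, h0, h1, rfl⟩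
  have := Complex.sq_norm (pt c s t).1
  rw [Complex.normSq_apply, pt_fst_re, pt_fst_im] at this
  have h2 : ‖(pt c s t).1‖ ^ 2 = 1 := by linarith
  exact (pow_eq_one_iff_of_nonneg (norm_nonneg _) two_ne_zero).1 h2

theorem pt_mem_indet {s : ℝ} (h : s ^ 2 = 1) : pt 0 s 1 ∈ indet := by
  rcases sq_eq_sq_iff_eq_or_eq_neg.1 (h.trans (one_pow 2).symm) with rfl | rfl <;> simp [pt, indet]

theorem den_pos {c s t : ℝ} (h : c ^ 2 + s ^ 2 = 1) (h0 : 0 ≤ t) (hx : pt c s t ∉ indet) :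
    0 < den c t := by
  rcases eq_or_ne t 1 with rfl | ht
  · have hc : c ≠ 0 := by
      rintro rfl
      exact hx (pt_mem_indet (by linarith))
    simp only [den]
    positivity
  · have : 1 - t ^ 2 ≠ 0 := fun h' => ht (by nlinarith)
    simp only [den]
    positivity

theorem den_mul (z t c s : ℂ) (hz : z = c + s * Complex.I) (h : c ^ 2 + s ^ 2 = 1) :
    (z ^ 2 + t ^ 2) * (1 + t ^ 2 * z ^ 2)
      = z ^ 2 * ((1 - t ^ 2) ^ 2 + 4 * t ^ 2 * c ^ 2) := by
  have hy : z * (c - s * Complex.I) = 1 := by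
    rw [hz]; linear_combination h - s ^ 2 * Complex.I_sq
  have h2 : 2 * c * z = z ^ 2 + 1 := by linear_combination -z * hz + hy
  linear_combination -t ^ 2 * (2 * c * z + z ^ 2 + 1) * h2

theorem hasDerivAt_R_line (z t c s a b : ℂ) (hz : z = c + s * Complex.I) (h : c ^ 2 + s ^ 2 = 1)
    (h1 : z ^ 2 + t ^ 2 ≠ 0) (h2 : 1 + t ^ 2 * z ^ 2 ≠ 0) :
    HasDerivAt (fun r : ℂ => R ((z, t) + r • (a * (Complex.I * z), b)))
      (4 * ((1 - t ^ 2 + 2 * t ^ 2 * c ^ 2) * a - 2 * t * s * c * b)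
          / ((1 - t ^ 2) ^ 2 + 4 * t ^ 2 * c ^ 2) * (Complex.I * (R (z, t)).1),
        8 * t * (1 - t ^ 2) * c * (-(t * (1 - t ^ 2) * s * a) + (1 + t ^ 2) * c * b)
          / ((1 - t ^ 2) ^ 2 + 4 * t ^ 2 * c ^ 2) ^ 2) 0 := by
  have e := den_mul z t c s hz h
  have hI := Complex.I_sq
  have hy : z * (c - s * Complex.I) = 1 := by
    rw [hz]; linear_combination h - s ^ 2 * hI
  have hz0 : z ≠ 0 := left_ne_zero_of_mul_eq_one hy
  -- Expressing `c`, `s` and the denominator through `z` makes the claim an identity in `z`, `t`.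
  have hc : c = (z ^ 2 + 1) / (2 * z) := by
    field_simp
    linear_combination -z * hz + hy
  have hs : s = -Complex.I * (z ^ 2 - 1) / (2 * z) := by
    field_simp
    linear_combination Complex.I * z * hz + Complex.I * hy + 2 * s * z * hI
  have e' : (1 - t ^ 2) ^ 2 + 4 * t ^ 2 * c ^ 2
      = (z ^ 2 + t ^ 2) * (1 + t ^ 2 * z ^ 2) / z ^ 2 := by
    field_simp
    linear_combination -e
  have dz : HasDerivAt (fun r : ℂ => z + r * (a * (Complex.I * z))) (a * (Complex.I * z)) 0 := by
    simpa using ((hasDerivAt_id (0 : ℂ)).mul_const (a * (Complex.I * z))).const_add z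
  have dt : HasDerivAt (fun r : ℂ => t + r * b) b 0 := by
    simpa using ((hasDerivAt_id (0 : ℂ)).mul_const b).const_add t
  have d₁ : HasDerivAt _ _ (0 : ℂ) := (dz.fun_pow 2).fun_add (dt.fun_pow 2)
  have d₂ : HasDerivAt _ _ (0 : ℂ) := ((dt.fun_pow 2).fun_mul (dz.fun_pow 2)).const_add 1
  have dR₁ := ((dz.fun_pow 2).fun_mul d₁).fun_div d₂ (by simpa using h2)
  have dR₂ := ((dt.fun_pow 2).fun_mul (((dz.fun_pow 2).add_const 1).fun_pow 2)).fun_div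
    (d₁.fun_mul d₂) (by simpa using ⟨h1, h2⟩)
  refine (dR₁.prodMk dR₂).congr_deriv ?_
  rw [e', hs, hc]
  simp only [R, Prod.mk.injEq, zero_mul, add_zero]
  constructor
  · field_simp
    ring_nf
    simp only [hI]
    ring
  · field_simp
    ring_nf

/-- The map and its differential in cylindrical coordinates, off the indeterminacy points. -/
theorem R_pt {c s t : ℝ} (h : c ^ 2 + s ^ 2 = 1) (hD : 0 < den c t) :
    (∃ c' s' : ℝ, c' ^ 2 + s' ^ 2 = 1 ∧ R (pt c s t) = pt c' s' (imageT c t)) ∧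
    DifferentiableAt ℂ R (pt c s t) ∧
    ∀ a b : ℝ, fderiv ℂ R (pt c s t) (tangent (pt c s t) a b)
      = tangent (R (pt c s t)) (imageA c s t a b) (imageB c s t a b) := by
  obtain ⟨z, hz⟩ : ∃ z : ℂ, z = c + s * Complex.I := ⟨_, rfl⟩
  have hpt : pt c s t = (z, (t : ℂ)) := by rw [hz]; rfl
  have hC : (c : ℂ) ^ 2 + (s : ℂ) ^ 2 = 1 := by exact_mod_cast h
  have e := den_mul z t c s hz hC
  have hD' : (1 - (t : ℂ) ^ 2) ^ 2 + 4 * (t : ℂ) ^ 2 * (c : ℂ) ^ 2 = (den c t : ℂ) := by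
    simp [den]
  have hD0 : (den c t : ℂ) ≠ 0 := by exact_mod_cast hD.ne'
  have hy : z * (c - s * Complex.I) = 1 := by
    rw [hz]; linear_combination hC - s ^ 2 * Complex.I_sq
  have hz0 : z ≠ 0 := left_ne_zero_of_mul_eq_one hy
  have hne : (z ^ 2 + (t : ℂ) ^ 2) * (1 + (t : ℂ) ^ 2 * z ^ 2) ≠ 0 := by
    rw [e, hD']
    exact mul_ne_zero (pow_ne_zero _ hz0) hD0
  have h1 := left_ne_zero_of_mul hne
  have h2 := right_ne_zero_of_mul hne
  have hdiff : DifferentiableAt ℂ R (pt c s t) := by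
    rw [hpt]
    unfold R
    fun_prop (disch := first | exact h2 | exact hne)
  refine ⟨?_, hdiff, fun a b => ?_⟩
  · have h2cz : 2 * c * z = z ^ 2 + 1 := by linear_combination -z * hz + hy
    have hR : R (pt c s t) = ((z ^ 2 + (t : ℂ) ^ 2) ^ 2 / den c t, (imageT c t : ℂ)) := by
      rw [hpt, imageT, R]
      refine Prod.ext ?_ ?_
      · rw [div_eq_div_iff h2 hD0, ← hD']
        linear_combination -(z ^ 2 + (t : ℂ) ^ 2) * e
      · push_cast
        rw [div_eq_div_iff hne hD0, e, ← hD']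
        linear_combination (-(t : ℂ) ^ 2 * ((1 - (t : ℂ) ^ 2) ^ 2 + 4 * (t : ℂ) ^ 2 * (c : ℂ) ^ 2))
          * (2 * c * z + z ^ 2 + 1) * h2cz
    -- The real and imaginary parts of `z² + t²` are `c² - s² + t²` and `2 c s`.
    refine ⟨((c ^ 2 - s ^ 2 + t ^ 2) ^ 2 - (2 * c * s) ^ 2) / den c t,
      2 * (c ^ 2 - s ^ 2 + t ^ 2) * (2 * c * s) / den c t, ?_, ?_⟩
    · have hs : s ^ 2 = 1 - c ^ 2 := by linarith
      have key : (c ^ 2 - s ^ 2 + t ^ 2) ^ 2 + (2 * c * s) ^ 2 = den c t := by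
        rw [mul_pow, hs, den]; ring
      field_simp
      rw [← key]
      ring
    · rw [hR, pt]
      refine Prod.ext ?_ rfl
      push_cast
      rw [hz]
      field_simp
      linear_combination (s ^ 4 * (Complex.I ^ 2 - 1) + 6 * c ^ 2 * s ^ 2
        + 4 * c * s ^ 3 * Complex.I + 2 * s ^ 2 * t ^ 2) * Complex.I_sq
  · have hline : HasDerivAt (fun r : ℂ => pt c s t + r • tangent (pt c s t) a b)
        (tangent (pt c s t) a b) 0 := by
      simpa using ((hasDerivAt_id (0 : ℂ)).smul_const (tangent (pt c s t) a b)).const_add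
        (pt c s t)
    have hcomp : HasDerivAt (fun r : ℂ => R (pt c s t + r • tangent (pt c s t) a b))
        (fderiv ℂ R (pt c s t) (tangent (pt c s t) a b)) 0 :=
      HasFDerivAt.comp_hasDerivAt_of_eq 0 hdiff.hasFDerivAt hline (by simp)
    have hform := hasDerivAt_R_line z t c s a b hz hC h1 h2
    rw [← hpt] at hform
    have : (tangent (pt c s t) a b) = (a * (Complex.I * z), (b : ℂ)) := by rw [hpt]; rfl
    rw [this] at hcomp ⊢
    rw [hcomp.unique hform, tangent, imageA, imageB, imageX, imageY, hD']
    push_cast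
    rfl

/-! ### Expansion of the Lorentz form -/

/-- The Lorentz form `dφ² - dt² / (1 - t²)` on the vector `a ∂_φ + b ∂_t` at height `t`. At the
top `t = 1` division by zero makes it `a²`, which is the intended value on horizontal vectors, the
only ones for which it is used there. -/
noncomputable def lorentz (t a b : ℝ) : ℝ := a ^ 2 - b ^ 2 / (1 - t ^ 2)

theorem lorentz_le_sq {t : ℝ} (h0 : 0 ≤ t) (h1 : t ≤ 1) (a b : ℝ) : lorentz t a b ≤ a ^ 2 := by
  have : 0 ≤ b ^ 2 / (1 - t ^ 2) := div_nonneg (sq_nonneg b) (by nlinarith)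
  rw [lorentz]
  linarith

theorem one_sub_imageT {c t : ℝ} (hD : 0 < den c t) :
    1 - imageT c t = (1 - t ^ 2) ^ 2 / den c t := by
  rw [imageT, eq_div_iff hD.ne', sub_mul, div_mul_cancel₀ _ hD.ne', den]
  ring

theorem imageT_nonneg {c t : ℝ} (hD : 0 < den c t) : 0 ≤ imageT c t := by
  unfold imageT
  positivity

theorem imageT_le_one {c t : ℝ} (hD : 0 < den c t) : imageT c t ≤ 1 := by
  have : 0 ≤ (1 - t ^ 2) ^ 2 / den c t := by positivity
  linarith [one_sub_imageT hD]

theorem one_sub_imageT_sq {c t : ℝ} (hD : 0 < den c t) :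
    1 - imageT c t ^ 2
      = (1 - t ^ 2) ^ 2 * ((1 - t ^ 2) ^ 2 + 8 * t ^ 2 * c ^ 2) / den c t ^ 2 := by
  have h : 1 + imageT c t = ((1 - t ^ 2) ^ 2 + 8 * t ^ 2 * c ^ 2) / den c t := by
    rw [imageT, eq_div_iff hD.ne', add_mul, div_mul_cancel₀ _ hD.ne', den]
    ring
  calc 1 - imageT c t ^ 2 = (1 - imageT c t) * (1 + imageT c t) := by ring
    _ = _ := by rw [one_sub_imageT hD, h]; field_simp

/-- At the top, the differential of `R` maps every tangent vector to a horizontal one. -/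
theorem imageB_eq_zero {c s t a b : ℝ} (hD : 0 < den c t) (h : imageT c t = 1) :
    imageB c s t a b = 0 := by
  have h1 := one_sub_imageT hD
  rw [h, sub_self, eq_comm, div_eq_zero_iff] at h1
  have h2 : 1 - t ^ 2 = 0 := by simpa [hD.ne'] using h1
  simp [imageB, h2]

/-- The nontrivial factor of the discriminant of the quadratic form in `four_mul_lorentz_le`, in
terms of `v = 1 - t²` and `w = cos² φ`. -/
theorem discriminant_factor_nonneg {v w : ℝ} (hv : 0 ≤ v) (hv1 : v ≤ 1) (hw : 0 ≤ w)
    (hw1 : w ≤ 1) :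
    0 ≤ v ^ 3 * (4 - v ^ 2) + 16 * (1 - v) * w *
      (8 * (1 - v) * w ^ 2 - v * (7 - 5 * v) * w + v * (1 + v - v ^ 2)) := by
  have hu : 0 ≤ 1 - v := by linarith
  rcases le_total v (4 / 5) with h | h
  -- Here the quadratic polynomial in `w` in the last factor has negative discriminant.
  · have h1 : 0 ≤ 8 * (1 - v) * w ^ 2 - v * (7 - 5 * v) * w + v * (1 + v - v ^ 2) := by
      have hd : v * (7 - 5 * v) ^ 2 ≤ 32 * (1 - v) * (1 + v - v ^ 2) := by
        nlinarith [mul_nonneg hv (sub_nonneg.2 h), mul_nonneg (mul_nonneg hv hv) (sub_nonneg.2 h)]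
      have hk : 0 < 32 * (1 - v) := by linarith
      have : 0 ≤ 32 * (1 - v) *
          (8 * (1 - v) * w ^ 2 - v * (7 - 5 * v) * w + v * (1 + v - v ^ 2)) := by
        nlinarith [sq_nonneg (16 * (1 - v) * w - v * (7 - 5 * v)),
          mul_nonneg hv (sub_nonneg.2 hd)]
      exact nonneg_of_mul_nonneg_right this hk
    have := mul_nonneg (mul_nonneg hu hw) h1
    have h2 : 0 ≤ v ^ 3 * (4 - v ^ 2) := mul_nonneg (by positivity) (by nlinarith)
    nlinarith
  -- Here it is at least `2 - 3 v`, and the first summand makes up for its negativity.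
  · have h1 : 2 - 3 * v ≤ 8 * (1 - v) * w ^ 2 - v * (7 - 5 * v) * w + v * (1 + v - v ^ 2) := by
      have e1 : 0 ≤ (5 * v - 4) * (1 - v) * (1 - w) :=
        mul_nonneg (mul_nonneg (by linarith) hu) (by linarith)
      have e2 : 0 ≤ (1 - v) * (8 * (1 - w) ^ 2 - 4 * (1 - w) + 2) :=
        mul_nonneg hu (by nlinarith [sq_nonneg (4 * (1 - w) - 1)])
      have e3 : 0 ≤ (1 - v) * ((1 - v) * (4 - v)) :=
        mul_nonneg hu (mul_nonneg hu (by linarith))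
      have e4 : 0 ≤ (5 * v - 4) * (1 - w) := mul_nonneg (by linarith) (by linarith)
      nlinarith
    have h2 := mul_le_mul_of_nonneg_left h1 (mul_nonneg hu hw)
    have h3 : (1 - v) * w * (3 * v - 2) ≤ (1 - v) * (3 * v - 2) := by
      nlinarith [mul_nonneg (mul_nonneg hu (sub_nonneg.2 hw1)) (by linarith : 0 ≤ 3 * v - 2)]
    have h4 : (1 - v) * (3 * v - 2) ≤ 1 / 12 := by nlinarith [sq_nonneg (6 * v - 5)]
    have h5 : (4 / 5 : ℝ) ^ 3 ≤ v ^ 3 := by gcongr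
    have h6 : v ^ 3 * 3 ≤ v ^ 3 * (4 - v ^ 2) :=
      mul_le_mul_of_nonneg_left (by nlinarith) (by positivity)
    norm_num at h5
    nlinarith

set_option maxHeartbeats 1000000 in
/-- The expansion of the Lorentz form with cleared denominators. -/
theorem lorentz_polynomial_nonneg {c s t : ℝ} (hcs : c ^ 2 + s ^ 2 = 1) (h0 : 0 ≤ t) (h1 : t < 1)
    (a b : ℝ) :
    0 ≤ 4 * (1 - t ^ 2) * imageX c s t a b ^ 2 * ((1 - t ^ 2) ^ 2 + 8 * t ^ 2 * c ^ 2)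
      - 16 * (1 - t ^ 2) * t ^ 2 * c ^ 2 * imageY c s t a b ^ 2
      - ((1 - t ^ 2) * a ^ 2 - b ^ 2) * den c t ^ 2
        * ((1 - t ^ 2) ^ 2 + 8 * t ^ 2 * c ^ 2) := by
  obtain ⟨D, hD⟩ : ∃ D, D = den c t := ⟨_, rfl⟩
  obtain ⟨E, hE⟩ : ∃ E, E = (1 - t ^ 2) ^ 2 + 8 * t ^ 2 * c ^ 2 := ⟨_, rfl⟩
  rw [← hD, ← hE]
  rw [den] at hD
  -- `(1 - t²)² c₀`, `(1 - t²) t s c k` and `c₂` are the coefficients of `a²`, `a b` and `b²`.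
  obtain ⟨k, hk⟩ : ∃ k, k = -8 * E * ((1 - t ^ 2) * (1 + t ^ 2) + D)
      + 32 * t ^ 2 * (1 + t ^ 2) * (1 - t ^ 2) * c ^ 2 := ⟨_, rfl⟩
  obtain ⟨c₀, hc₀⟩ : ∃ c₀, c₀ = (1 - t ^ 2) ^ 3 * (1 + t ^ 2) * (3 - t ^ 2)
      + 16 * (1 - t ^ 2) * t ^ 2 * (2 - t ^ 4) * c ^ 2
      + 16 * t ^ 4 * (5 + 3 * t ^ 2) * c ^ 4 := ⟨_, rfl⟩
  obtain ⟨c₂, hc₂⟩ : ∃ c₂, c₂ = E * (16 * t ^ 2 * (1 - c ^ 2) * c ^ 2 * (1 - t ^ 2) + D * D)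
      - 16 * t ^ 2 * (1 + t ^ 2) ^ 2 * c ^ 4 * (1 - t ^ 2) := ⟨_, rfl⟩
  have hs2 : s ^ 2 = 1 - c ^ 2 := by linarith
  have form : 4 * (1 - t ^ 2) * imageX c s t a b ^ 2 * E
      - 16 * (1 - t ^ 2) * t ^ 2 * c ^ 2 * imageY c s t a b ^ 2
      - ((1 - t ^ 2) * a ^ 2 - b ^ 2) * D ^ 2 * E
      = (1 - t ^ 2) ^ 2 * c₀ * a ^ 2 + (1 - t ^ 2) * t * s * c * k * a * b + c₂ * b ^ 2 := by
    rw [imageX, imageY]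
    subst hk hc₀ hc₂ hE hD
    ring_nf
    simp only [hs2]
    ring
  have disc : 4 * c₀ * c₂ - (t * s * c * k) ^ 2 = 4 * D ^ 2 * E * ((1 - t ^ 2) ^ 3
      * (4 - (1 - t ^ 2) ^ 2) + 16 * (1 - (1 - t ^ 2)) * c ^ 2 *
      (8 * (1 - (1 - t ^ 2)) * (c ^ 2) ^ 2 - (1 - t ^ 2) * (7 - 5 * (1 - t ^ 2)) * c ^ 2
        + (1 - t ^ 2) * (1 + (1 - t ^ 2) - (1 - t ^ 2) ^ 2))) := by
    have e : (t * s * c * k) ^ 2 = t ^ 2 * (1 - c ^ 2) * c ^ 2 * k ^ 2 := by rw [← hs2]; ring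
    rw [e]
    subst hk hc₀ hc₂ hE hD
    ring
  have ht2 : t ^ 2 < 1 := by nlinarith
  have hv : 0 < 1 - t ^ 2 := by linarith
  have hE0 : 0 ≤ E := by rw [hE]; positivity
  have hdisc : 0 ≤ 4 * c₀ * c₂ - (t * s * c * k) ^ 2 := by
    rw [disc]
    exact mul_nonneg (by positivity) (discriminant_factor_nonneg hv.le (by nlinarith [sq_nonneg t])
      (sq_nonneg c) (by nlinarith [sq_nonneg s]))
  have hc₀pos : 0 < 4 * c₀ := by
    have e1 : 0 < (1 - t ^ 2) ^ 3 * (1 + t ^ 2) * (3 - t ^ 2) :=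
      mul_pos (by positivity) (by linarith)
    have e2 : 0 ≤ 16 * (1 - t ^ 2) * t ^ 2 * (2 - t ^ 4) * c ^ 2 :=
      mul_nonneg (mul_nonneg (by positivity) (by nlinarith [sq_nonneg t])) (sq_nonneg c)
    have e3 : 0 ≤ 16 * t ^ 4 * (5 + 3 * t ^ 2) * c ^ 4 := by positivity
    rw [hc₀]
    linarith
  rw [form]
  refine nonneg_of_mul_nonneg_right (a := 4 * c₀) ?_ hc₀pos
  have square : 4 * c₀ * ((1 - t ^ 2) ^ 2 * c₀ * a ^ 2 + (1 - t ^ 2) * t * s * c * k * a * b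
      + c₂ * b ^ 2) = (2 * (1 - t ^ 2) * c₀ * a + t * s * c * k * b) ^ 2
      + (4 * c₀ * c₂ - (t * s * c * k) ^ 2) * b ^ 2 := by ring
  rw [square]
  positivity

/-- The differential of `R` multiplies the Lorentz form by at least `4`. -/
theorem four_mul_lorentz_le {c s t : ℝ} (hcs : c ^ 2 + s ^ 2 = 1) (h0 : 0 ≤ t) (h1 : t ≤ 1)
    (hD : 0 < den c t) {a b : ℝ} (hb : t = 1 → b = 0) :
    4 * lorentz t a b ≤ lorentz (imageT c t) (imageA c s t a b) (imageB c s t a b) := by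
  rcases h1.eq_or_lt with rfl | h1
  · obtain rfl := hb rfl
    have hc : c ≠ 0 := by
      rintro rfl
      simp [den] at hD
    have e : imageA c s 1 a 0 = 2 * a := by
      simp only [imageA, imageX, den]
      field_simp
      ring
    rw [imageB_eq_zero hD (by rw [imageT, den]; field_simp; ring), e, lorentz, lorentz]
    apply le_of_eq
    ring
  · have hv : 0 < 1 - t ^ 2 := by nlinarith
    have hE : 0 < (1 - t ^ 2) ^ 2 + 8 * t ^ 2 * c ^ 2 := by positivity
    have hP := lorentz_polynomial_nonneg hcs h0 h1 a b
    rw [lorentz, lorentz, one_sub_imageT_sq hD, imageA, imageB, ← sub_nonneg]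
    have e : (4 * imageX c s t a b / den c t) ^ 2
        - (8 * t * (1 - t ^ 2) * c * imageY c s t a b / den c t ^ 2) ^ 2
          / ((1 - t ^ 2) ^ 2 * ((1 - t ^ 2) ^ 2 + 8 * t ^ 2 * c ^ 2) / den c t ^ 2)
        - 4 * (a ^ 2 - b ^ 2 / (1 - t ^ 2))
        = 4 * (4 * (1 - t ^ 2) * imageX c s t a b ^ 2 * ((1 - t ^ 2) ^ 2 + 8 * t ^ 2 * c ^ 2)
          - 16 * (1 - t ^ 2) * t ^ 2 * c ^ 2 * imageY c s t a b ^ 2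
          - ((1 - t ^ 2) * a ^ 2 - b ^ 2) * den c t ^ 2
            * ((1 - t ^ 2) ^ 2 + 8 * t ^ 2 * c ^ 2))
          / ((1 - t ^ 2) * den c t ^ 2 * ((1 - t ^ 2) ^ 2 + 8 * t ^ 2 * c ^ 2)) := by
      field_simp
      ring
    rw [e]
    positivity

/-! ### The first iterate -/

/-- Because `1 - T² = (1 - t²)² E / den²` with `E ≥ 8 t² c²` for the height `T` of the image, the
negative part of its Lorentz form is at most half of the positive part whenever
`|imageY| ≤ imageX`. -/
theorem one_eighth_le_lorentz {c s t a b : ℝ} (hD : 0 < den c t)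
    (hY : |imageY c s t a b| ≤ imageX c s t a b) (hX : den c t ≤ 8 * imageX c s t a b) :
    1 / 8 ≤ lorentz (imageT c t) (imageA c s t a b) (imageB c s t a b) := by
  rw [lorentz, one_sub_imageT_sq hD, imageA, imageB]
  have hX2 : 1 ≤ (8 * imageX c s t a b / den c t) ^ 2 :=
    one_le_pow₀ ((one_le_div hD).2 hX)
  have hYX : imageY c s t a b ^ 2 ≤ imageX c s t a b ^ 2 := sq_le_sq' (by linarith [abs_le.1 hY])
    (le_of_abs_le hY)
  have key : (8 * t * (1 - t ^ 2) * c * imageY c s t a b / den c t ^ 2) ^ 2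
      / ((1 - t ^ 2) ^ 2 * ((1 - t ^ 2) ^ 2 + 8 * t ^ 2 * c ^ 2) / den c t ^ 2)
      ≤ 8 * imageX c s t a b ^ 2 / den c t ^ 2 := by
    refine div_le_of_le_mul₀ (by positivity) (by positivity) ?_
    have e1 : (8 * t * (1 - t ^ 2) * c * imageY c s t a b / den c t ^ 2) ^ 2
        = (8 * imageY c s t a b ^ 2) * ((1 - t ^ 2) ^ 2 * (8 * t ^ 2 * c ^ 2))
          / den c t ^ 4 := by
      field_simp
    have e2 : 8 * imageX c s t a b ^ 2 / den c t ^ 2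
        * ((1 - t ^ 2) ^ 2 * ((1 - t ^ 2) ^ 2 + 8 * t ^ 2 * c ^ 2) / den c t ^ 2)
        = (8 * imageX c s t a b ^ 2) * ((1 - t ^ 2) ^ 2 * ((1 - t ^ 2) ^ 2 + 8 * t ^ 2 * c ^ 2))
          / den c t ^ 4 := by
      field_simp
    rw [e1, e2]
    gcongr
    nlinarith [sq_nonneg (1 - t ^ 2)]
  have e : (8 * imageX c s t a b / den c t) ^ 2 = 64 * (imageX c s t a b ^ 2 / den c t ^ 2) := by
    ring
  have e' : (4 * imageX c s t a b / den c t) ^ 2 = 16 * (imageX c s t a b ^ 2 / den c t ^ 2) := by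
    ring
  rw [e] at hX2
  rw [e']
  rw [mul_div_assoc 8 (imageX c s t a b ^ 2)] at key
  linarith

/-- The estimate on the null vector `∂_φ + r ∂_t`. With `t = cos θ` and `r = sin θ`, the
right-hand side is `cos² φ + cos² (φ + θ)`. -/
theorem abs_imageY_le_imageX_of_null {c s t r : ℝ} (hcs : c ^ 2 + s ^ 2 = 1)
    (hr : r ^ 2 = 1 - t ^ 2) : |imageY c s t 1 r| ≤ imageX c s t 1 r := by
  have eX : imageX c s t 1 r = c ^ 2 + (t * c - s * r) ^ 2 := by
    rw [imageX]
    linear_combination (r ^ 2) * (-hcs) + (c ^ 2 - 1) * hr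
  have eY : imageY c s t 1 r = r * (c + t * (t * c - s * r)) := by
    rw [imageY]
    linear_combination (t * s) * hr
  rw [eX, eY]
  apply abs_le_of_sq_le_sq _ (by positivity)
  have h2 : r ^ 2 = c ^ 2 + (t * c - s * r) ^ 2 - 2 * t * c * (t * c - s * r) := by
    linear_combination (r ^ 2) * (-hcs) + c ^ 2 * hr
  set β := t * c - s * r
  have : t ^ 2 ≤ 1 := by nlinarith
  rw [mul_pow, h2]
  have h3 : (c + t * β) ^ 2 ≤ c ^ 2 + 2 * t * c * β + β ^ 2 := by nlinarith [sq_nonneg β]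
  have h4 : 0 ≤ c ^ 2 + β ^ 2 - 2 * t * c * β := by
    have := sq_nonneg r
    linarith
  nlinarith [mul_le_mul_of_nonneg_left h3 h4, sq_nonneg (t * c * β)]

theorem abs_imageY_le_imageX {c s t p : ℝ} (hcs : c ^ 2 + s ^ 2 = 1) (h0 : 0 ≤ t) (h1 : t ≤ 1)
    (hp : |p| ≤ √(1 - t ^ 2)) : |imageY c s t 1 p| ≤ imageX c s t 1 p := by
  have hr := Real.sq_sqrt (by nlinarith : 0 ≤ 1 - t ^ 2)
  have hr0 := Real.sqrt_nonneg (1 - t ^ 2)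
  set r := √(1 - t ^ 2)
  have hpos := abs_le.1 (abs_imageY_le_imageX_of_null (r := r) hcs hr)
  have hneg := abs_le.1 (abs_imageY_le_imageX_of_null (t := t) (r := -r) hcs
    (by rw [neg_sq, hr]))
  obtain ⟨hp1, hp2⟩ := abs_le.1 hp
  rcases hr0.eq_or_lt with h | h
  · have : p = r := by linarith
    rw [this]
    exact abs_le.2 hpos
  -- Both sides are affine in the slope, so it is enough to interpolate between the null vectors.
  · simp only [imageX, imageY] at hpos hneg ⊢
    have e1 : 0 ≤ r - p := by linarith
    have e2 : 0 ≤ r + p := by linarith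
    have h2r : 0 < 2 * r := by linarith
    refine abs_le.2 ⟨?_, ?_⟩
    · have := add_nonneg (mul_nonneg e2 (neg_le_iff_add_nonneg.1 hpos.1))
        (mul_nonneg e1 (neg_le_iff_add_nonneg.1 hneg.1))
      refine neg_le_iff_add_nonneg.2 (nonneg_of_mul_nonneg_right (a := 2 * r) ?_ h2r)
      linarith
    · have := add_nonneg (mul_nonneg e2 (sub_nonneg.2 hpos.2))
        (mul_nonneg e1 (sub_nonneg.2 hneg.2))
      refine sub_nonneg.1 (nonneg_of_mul_nonneg_right (a := 2 * r) ?_ h2r)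
      linarith

theorem den_le_eight_mul_imageX {c s t p : ℝ} (hcs : c ^ 2 + s ^ 2 = 1) (h0 : 0 ≤ t) (h1 : t ≤ 1)
    (hp : |p| ≤ √(1 - t ^ 2)) : den c t ≤ 8 * imageX c s t 1 p := by
  have hr := Real.sq_sqrt (by nlinarith : 0 ≤ 1 - t ^ 2)
  set r := √(1 - t ^ 2)
  have hs : |s| ≤ 1 := abs_le_one_iff_mul_self_le_one.2 (by nlinarith)
  have h : t * s * c * p ≤ t * |c| * r := by
    calc t * s * c * p ≤ |t * s * c * p| := le_abs_self _
      _ = t * |s| * |c| * |p| := by rw [abs_mul, abs_mul, abs_mul, abs_of_nonneg h0]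
      _ ≤ t * 1 * |c| * r := by gcongr
      _ = t * |c| * r := by ring
  rw [den, imageX, ← sq_abs c]
  nlinarith [sq_nonneg (t * |c| * 3 - 2 * r), sq_nonneg r, sq_nonneg t, sq_nonneg (t * |c|)]

/-! ### The modified cone field -/

/-- The distance of `φ` to `π / 2 + π ℤ` lies in `[0, π / 2]`, and its sine is `|cos φ|`. -/
theorem absEps_spec {x : ℂ × ℂ} (hx : x ∈ cylinder) :
    0 ≤ absEps x ∧ absEps x ≤ Real.pi / 2 ∧ Real.sin (absEps x) = |x.1.re| := by
  have h0 : 0 ≤ absEps x := norm_nonneg _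
  have h1 : absEps x ≤ Real.pi / 2 := by
    have := AddCircle.norm_le_half_period Real.pi
      (x := ((Real.pi / 2 - Complex.arg x.1 : ℝ) : AddCircle Real.pi)) Real.pi_ne_zero
    rwa [abs_of_pos Real.pi_pos] at this
  refine ⟨h0, h1, ?_⟩
  have h2 : 0 ≤ Real.sin (absEps x) :=
    Real.sin_nonneg_of_nonneg_of_le_pi h0 (by linarith [Real.pi_pos])
  have hz : x.1 ≠ 0 := by
    intro h
    have := hx.1
    simp [h] at this
  have h3 : x.1.re = Real.cos (Complex.arg x.1) := by
    rw [Complex.cos_arg hz, hx.1, div_one]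
  obtain ⟨k, hk⟩ : ∃ k : ℤ, absEps x = |Real.pi / 2 - Complex.arg x.1 - k * Real.pi| :=
    ⟨_, AddCircle.norm_eq Real.pi⟩
  rw [← abs_of_nonneg h2, hk, h3, ← Real.sin_pi_div_two_sub]
  rcases abs_choice (Real.pi / 2 - Complex.arg x.1 - k * Real.pi) with h | h <;> rw [h]
  · rw [Real.sin_sub_int_mul_pi, abs_mul]
    simp
  · rw [Real.sin_neg, abs_neg, Real.sin_sub_int_mul_pi, abs_mul]
    simp

theorem algSlope_pt (c s t : ℝ) : algSlope (pt c s t) = √(1 - t ^ 2) := by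
  rw [algSlope, tau, pt_snd_re]
  congr 1
  ring

/-- In the modified part of the cone field, the slope and `1 - t²` are small compared with `cos φ`
and `cos² φ`. -/
theorem exists_threshold (δ : ℝ → ℝ) (hδ : Tendsto δ (𝓝[>] 0) (𝓝 0)) :
    ∃ ε₀ : ℝ, 0 < ε₀ ∧ ∀ εb : ℝ, 0 < εb → εb < ε₀ → ∀ σ : ℂ × ℂ → ℝ, IsModifiedSlope δ εb σ →
      ∀ x ∈ regionV' εb, x ∉ indet →
        0 < σ x ∧ σ x ≤ 7 / 20 * |x.1.re| ∧ 1 - x.2.re ^ 2 ≤ 3 / 25 * x.1.re ^ 2 := by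
  have hev : ∀ᶠ r in 𝓝[>] (0 : ℝ), |δ r| < 1 / 200 := by
    have := hδ (Metric.ball_mem_nhds 0 (by norm_num : (0 : ℝ) < 1 / 200))
    filter_upwards [this] with r hr
    simpa using hr
  obtain ⟨e, he, hδe⟩ := mem_nhdsGT_iff_exists_Ioo_subset.1 hev
  have he0 : 0 < e := he
  have hsin : ∀ m : ℝ, 0 < m → m < 1 / 10 → 99 / 100 * m ≤ Real.sin m := by
    intro m h0 h1
    have := Real.sin_gt_sub_cube h0
    have h2 : m ^ 3 ≤ 1 / 100 * m := by
      have : m ^ 2 ≤ 1 / 100 := by nlinarith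
      nlinarith
    linarith
  refine ⟨min e (1 / 10), by positivity, fun εb hb0 hb1 σ hσ x hx hxi => ?_⟩
  obtain ⟨hbe, hb10⟩ := lt_min_iff.1 hb1
  have hcyl : x ∈ cylinder := hx.1.1
  have hτb : tau x ≤ εb ^ 2 / 18 := hx.1.2
  have hτε : tau x ≤ absEps x ^ 2 / 18 := hx.2
  obtain ⟨hε0, hεπ, hεc⟩ := absEps_spec hcyl
  -- `m` is the smaller of `|ε|` and the threshold.
  obtain ⟨m, hm0, hσ0, hσm, hτm, hmc⟩ : ∃ m : ℝ, 0 < m ∧ 0 < σ x ∧ σ x ≤ 34 / 100 * m ∧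
      tau x ≤ m ^ 2 / 18 ∧ 99 / 100 * m ≤ |x.1.re| := by
    rcases lt_or_ge (absEps x) εb with h | h
    · have hpos : 0 < absEps x := by
        refine hε0.lt_of_ne' fun h0 => hxi ?_
        obtain ⟨c, s, t, hcs, ht0, ht1, rfl⟩ := exists_eq_pt hcyl
        rw [h0, Real.sin_zero, pt_fst_re, eq_comm, abs_eq_zero] at hεc
        rw [h0, tau, pt_snd_re] at hτε
        obtain rfl : t = 1 := by linarith
        subst hεc
        exact pt_mem_indet (by linarith)
      have hg := abs_le.1 (hσ.grey x ⟨hx, h⟩)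
      have hd : |δ (absEps x)| < 1 / 200 := hδe ⟨hpos, h.trans hbe⟩
      have hd' := abs_lt.1 hd
      have hmul : δ (absEps x) * absEps x ≤ 1 / 200 * absEps x := by
        gcongr
        exact hd'.2.le
      refine ⟨absEps x, hpos, by linarith, by linarith, hτε, ?_⟩
      rw [← hεc]
      exact hsin _ hpos (h.trans hb10)
    · have hbl := hσ.black x ⟨hx.1, fun hU => absurd hU.2 (not_lt.2 h)⟩
      refine ⟨εb, hb0, ?_, ?_, hτb, ?_⟩
      · rw [hbl]
        exact Real.sqrt_pos.2 (mul_pos (by positivity) (by nlinarith))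
      · rw [hbl]
        refine (Real.sqrt_le_left (by positivity)).2 ?_
        nlinarith [sq_nonneg (εb ^ 2), sq_nonneg εb]
      · rw [← hεc]
        refine (hsin _ hb0 hb10).trans (Real.sin_le_sin_of_le_of_le_pi_div_two ?_ hεπ h)
        linarith [Real.pi_pos]
  refine ⟨hσ0, by linarith, ?_⟩
  have hsq : (99 / 100 * m) ^ 2 ≤ x.1.re ^ 2 := by
    rw [← sq_abs x.1.re]
    gcongr
  rw [tau] at hτm
  nlinarith [sq_nonneg (1 - x.2.re), sq_nonneg m]

theorem abs_imageY_le_imageX_of_small {c s t p : ℝ} (hcs : c ^ 2 + s ^ 2 = 1) (h0 : 0 ≤ t)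
    (h1 : t ≤ 1) (hp : |p| ≤ 7 / 20 * |c|) (ht : 1 - t ^ 2 ≤ 3 / 25 * c ^ 2) :
    |imageY c s t 1 p| ≤ imageX c s t 1 p ∧ den c t ≤ 8 * imageX c s t 1 p := by
  have hs : |s| ≤ 1 := abs_le_one_iff_mul_self_le_one.2 (by nlinarith)
  have hv : 0 ≤ 1 - t ^ 2 := by nlinarith
  have hc1 : c ^ 2 ≤ 1 := by nlinarith [sq_nonneg s]
  have ht9 : 9 / 10 ≤ t := by nlinarith
  have hcp : |c * p| ≤ 7 / 20 * c ^ 2 := by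
    calc |c * p| = |c| * |p| := abs_mul _ _
      _ ≤ |c| * (7 / 20 * |c|) := by gcongr
      _ = 7 / 20 * c ^ 2 := by rw [← sq_abs c]; ring
  have hscp : |s * (c * p)| ≤ 7 / 20 * c ^ 2 := by
    rw [abs_mul]
    calc |s| * |c * p| ≤ 1 * (7 / 20 * c ^ 2) := by gcongr
      _ = _ := one_mul _
  have hY : |imageY c s t 1 p| ≤ 3 / 25 * c ^ 2 + 2 * (7 / 20 * c ^ 2) := by
    rw [imageY]
    refine (abs_add_le _ _).trans (add_le_add ?_ ?_)
    · rw [abs_neg, mul_one, abs_mul, abs_mul, abs_of_nonneg h0, abs_of_nonneg hv]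
      calc t * (1 - t ^ 2) * |s| ≤ 1 * (1 - t ^ 2) * 1 := by gcongr
        _ ≤ _ := by linarith
    · rw [mul_assoc, abs_mul, abs_of_nonneg (by positivity)]
      gcongr
      nlinarith
  have hX : 9 / 10 * c ^ 2 ≤ imageX c s t 1 p := by
    have e1 : t * (s * (c * p)) ≤ t * (7 / 20 * c ^ 2) :=
      mul_le_mul_of_nonneg_left (le_of_abs_le hscp) h0
    have e2 : 0 ≤ (t - 9 / 10) * (2 * t + 11 / 10) * c ^ 2 :=
      mul_nonneg (mul_nonneg (by linarith) (by linarith)) (sq_nonneg c)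
    rw [imageX]
    nlinarith
  refine ⟨by nlinarith [sq_nonneg c], ?_⟩
  have hv2 : (1 - t ^ 2) ^ 2 ≤ 3 / 25 * c ^ 2 := by nlinarith
  have htc : t ^ 2 * c ^ 2 ≤ c ^ 2 := by nlinarith [sq_nonneg c]
  rw [den]
  nlinarith [sq_nonneg c]

/-! ### Orbits -/

theorem abs_lt_of_lorentz_pos {t a b : ℝ} (h0 : 0 ≤ t) (h1 : t < 1) (h : 0 < lorentz t a b) :
    |b| < √(1 - t ^ 2) * |a| := by
  have hv : 0 < 1 - t ^ 2 := by nlinarith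
  rw [lorentz, sub_pos, div_lt_iff₀ hv] at h
  rw [← Real.sqrt_sq_eq_abs, ← Real.sqrt_sq_eq_abs, ← Real.sqrt_mul hv.le]
  exact Real.sqrt_lt_sqrt (sq_nonneg b) (by linarith)

/-- Along an orbit, the Lorentz form grows at least like `4ⁿ`. -/
theorem lorentz_iterate {c s t : ℝ} (hcs : c ^ 2 + s ^ 2 = 1) (h0 : 0 ≤ t) (h1 : t ≤ 1)
    {a b : ℝ} (hb : t = 1 → b = 0) (n : ℕ) (hn : ∀ k < n, R^[k] (pt c s t) ∉ indet) :
    DifferentiableAt ℂ (R^[n]) (pt c s t) ∧ ∃ c' s' t' a' b' : ℝ, c' ^ 2 + s' ^ 2 = 1 ∧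
      0 ≤ t' ∧ t' ≤ 1 ∧ (t' = 1 → b' = 0) ∧ R^[n] (pt c s t) = pt c' s' t' ∧
      fderiv ℂ (R^[n]) (pt c s t) (tangent (pt c s t) a b) = tangent (pt c' s' t') a' b' ∧
      4 ^ n * lorentz t a b ≤ lorentz t' a' b' := by
  induction n with
  | zero =>
    refine ⟨differentiableAt_id, c, s, t, a, b, hcs, h0, h1, hb, rfl, ?_, by simp⟩
    rw [Function.iterate_zero, fderiv_id]
    rfl
  | succ n ih =>
    obtain ⟨hd, c', s', t', a', b', hcs', h0', h1', hb', hpt, hfd, hl⟩ :=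
      ih fun k hk => hn k (hk.trans n.lt_succ_self)
    have hi : pt c' s' t' ∉ indet := by rw [← hpt]; exact hn n n.lt_succ_self
    have hD := den_pos hcs' h0' hi
    obtain ⟨⟨c'', s'', hcs'', hR⟩, hdR, hfR⟩ := R_pt hcs' hD
    have hdR' : DifferentiableAt ℂ R (R^[n] (pt c s t)) := by rwa [hpt]
    rw [Function.iterate_succ']
    refine ⟨hdR'.comp _ hd, c'', s'', imageT c' t', imageA c' s' t' a' b', imageB c' s' t' a' b',
      hcs'', imageT_nonneg hD, imageT_le_one hD, imageB_eq_zero hD, ?_, ?_, ?_⟩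
    · rw [Function.comp_apply, hpt, hR]
    · rw [fderiv_comp _ hdR' hd, ContinuousLinearMap.comp_apply, hfd, hpt, hfR, hR]
    · calc (4 : ℝ) ^ (n + 1) * lorentz t a b = 4 * (4 ^ n * lorentz t a b) := by ring
        _ ≤ 4 * lorentz t' a' b' := by gcongr
        _ ≤ _ := four_mul_lorentz_le hcs' h0' h1' hD hb'

theorem euclNorm_tangent {c s : ℝ} (t a b : ℝ) (hcs : c ^ 2 + s ^ 2 = 1) :
    euclNorm (tangent (pt c s t) a b) = √(a ^ 2 + b ^ 2) := by
  have hz : ‖(pt c s t).1‖ ^ 2 = 1 := by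
    rw [Complex.sq_norm, Complex.normSq_apply, pt_fst_re, pt_fst_im]
    linarith
  rw [euclNorm, tangent]
  congr 1
  simp only [norm_mul, Complex.norm_I, one_mul, Complex.norm_real, mul_pow, hz, mul_one,
    Real.norm_eq_abs, sq_abs]

/-- The first iterate turns each vector of a modified cone into a vector whose Lorentz form is
at least an eighth of the square of the original `∂_φ`-component. -/
theorem IsModifiedSlope.le_lorentz {δ : ℝ → ℝ} {εb : ℝ} {σ : ℂ × ℂ → ℝ}
    (hσ : IsModifiedSlope δ εb σ)
    (hV : ∀ x ∈ regionV' εb, x ∉ indet →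
      0 < σ x ∧ σ x ≤ 7 / 20 * |x.1.re| ∧ 1 - x.2.re ^ 2 ≤ 3 / 25 * x.1.re ^ 2)
    {c s t : ℝ} (hcs : c ^ 2 + s ^ 2 = 1) (h0 : 0 ≤ t) (h1 : t ≤ 1) (hx : pt c s t ∉ indet)
    {a b : ℝ} (hab : |b| < σ (pt c s t) * |a|) :
    0 < a ^ 2 ∧ b ^ 2 ≤ a ^ 2 ∧
      a ^ 2 / 8 ≤ lorentz (imageT c t) (imageA c s t a b) (imageB c s t a b) := by
  have hcyl := pt_mem_cylinder hcs h0 h1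
  have hD := den_pos hcs h0 hx
  have ha : a ≠ 0 := by
    rintro rfl
    simp [(abs_nonneg b).not_gt] at hab
  obtain ⟨p, rfl⟩ : ∃ p, b = a * p := ⟨b / a, by field_simp⟩
  have hp : |p| < σ (pt c s t) := by
    rw [abs_mul, mul_comm] at hab
    exact lt_of_mul_lt_mul_right hab (abs_nonneg a)
  obtain ⟨hp1, hY, hX⟩ : |p| ≤ 1 ∧ |imageY c s t 1 p| ≤ imageX c s t 1 p ∧
      den c t ≤ 8 * imageX c s t 1 p := by
    by_cases hx' : pt c s t ∈ regionV' εb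
    · obtain ⟨-, h2, h3⟩ := hV _ hx' hx
      rw [pt_fst_re] at h2 h3
      rw [pt_snd_re] at h3
      have hc : |c| ≤ 1 := abs_le_one_iff_mul_self_le_one.2 (by nlinarith [sq_nonneg s])
      exact ⟨by linarith, abs_imageY_le_imageX_of_small hcs h0 h1 (hp.le.trans h2) h3⟩
    · have h2 := hp.le
      rw [hσ.white _ ⟨hcyl, hx'⟩, algSlope_pt] at h2
      have h3 : √(1 - t ^ 2) ≤ 1 := Real.sqrt_le_one.2 (by nlinarith [sq_nonneg t])
      exact ⟨h2.trans h3, abs_imageY_le_imageX hcs h0 h1 h2, den_le_eight_mul_imageX hcs h0 h1 h2⟩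
  have hl := one_eighth_le_lorentz hD hY hX
  have hA : imageA c s t a (a * p) = a * imageA c s t 1 p := by
    simp only [imageA, imageX]
    ring
  have hB : imageB c s t a (a * p) = a * imageB c s t 1 p := by
    simp only [imageB, imageY]
    ring
  have hsq : p ^ 2 ≤ 1 := (sq_le_one_iff_abs_le_one p).2 hp1
  refine ⟨by positivity, ?_, ?_⟩
  · rw [mul_pow]
    nlinarith [sq_nonneg a]
  · rw [hA, hB, lorentz, mul_pow, mul_pow, mul_div_assoc, ← mul_sub]
    rw [lorentz] at hl
    nlinarith [sq_nonneg a]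

end DHL

theorem mainTheorem4 (δ : ℝ → ℝ) (hδ : Tendsto δ (𝓝[>] 0) (𝓝 0)) :
    ∃ ε₀ : ℝ, 0 < ε₀ ∧ ∀ εb : ℝ, 0 < εb → εb < ε₀ →
      ∀ s : ℂ × ℂ → ℝ, DHL.IsModifiedSlope δ εb s →
        DHL.IsHorizontallyExpanding (DHL.slopeCone s) 2 := by
  obtain ⟨ε₀, hε₀, H⟩ := DHL.exists_threshold δ hδ
  refine ⟨ε₀, hε₀, fun εb hb0 hb1 σ hσ => ⟨one_lt_two, ?_, 1 / 8, by norm_num, ?_⟩⟩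
  · rintro x ⟨hx, hxi⟩ hRx v ⟨a, b, rfl, hab⟩
    obtain ⟨c, s, t, hcs, h0, h1, rfl⟩ := DHL.exists_eq_pt hx
    have hD := DHL.den_pos hcs h0 hxi
    obtain ⟨⟨c', s', hcs', hR⟩, -, hfd⟩ := DHL.R_pt hcs hD
    obtain ⟨ha, -, hl⟩ := hσ.le_lorentz (H εb hb0 hb1 σ hσ) hcs h0 h1 hxi hab
    have hT0 := DHL.imageT_nonneg hD
    have hT1 := DHL.imageT_le_one hD
    have hcyl := DHL.pt_mem_cylinder hcs' hT0 hT1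
    have hl0 : 0 < DHL.lorentz (DHL.imageT c t) (DHL.imageA c s t a b) (DHL.imageB c s t a b) := by
      linarith
    refine ⟨_, _, hfd a b, ?_⟩
    rw [hR] at hRx ⊢
    rcases hT1.eq_or_lt with h | h
    -- At the top the algebraic cone is empty, but the image vector is horizontal.
    · have hV' : DHL.pt c' s' (DHL.imageT c t) ∈ DHL.regionV' εb := by
        refine ⟨⟨hcyl, ?_⟩, ?_⟩ <;> rw [DHL.tau, DHL.pt_snd_re, h, sub_self] <;> positivity
      have hpos := (H εb hb0 hb1 σ hσ _ hV' hRx).1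
      have hA := hl0.trans_le (DHL.lorentz_le_sq hT0 hT1 _ _)
      rw [DHL.imageB_eq_zero hD h, abs_zero]
      exact mul_pos hpos (abs_pos.2 (pow_ne_zero_iff two_ne_zero |>.1 hA.ne'))
    · refine (DHL.abs_lt_of_lorentz_pos hT0 h hl0).trans_le ?_
      have := hσ.alg_le _ hcyl
      rw [DHL.algSlope_pt] at this
      gcongr
  · rintro x ⟨hx, hxi⟩ n hn v ⟨a, b, rfl, hab⟩
    obtain ⟨c, s, t, hcs, h0, h1, rfl⟩ := DHL.exists_eq_pt hx
    obtain ⟨ha, hba, hl⟩ := hσ.le_lorentz (H εb hb0 hb1 σ hσ) hcs h0 h1 hxi hab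
    change 1 / 8 * 2 ^ n * DHL.euclNorm (DHL.tangent (DHL.pt c s t) a b)
      ≤ DHL.euclNorm (fderiv ℂ (DHL.R^[n]) (DHL.pt c s t) (DHL.tangent (DHL.pt c s t) a b))
    rcases n with _ | n
    · rw [Function.iterate_zero, fderiv_id, ContinuousLinearMap.id_apply]
      have : 0 ≤ DHL.euclNorm (DHL.tangent (DHL.pt c s t) a b) := Real.sqrt_nonneg _
      linarith
    · have hD := DHL.den_pos hcs h0 hxi
      obtain ⟨⟨c', s', hcs', hR⟩, hdR, hfd⟩ := DHL.R_pt hcs hD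
      obtain ⟨hdn, c'', s'', t'', a'', b'', hcs'', h0'', h1'', -, -, hfn, hln⟩ :=
        DHL.lorentz_iterate hcs' (DHL.imageT_nonneg hD) (DHL.imageT_le_one hD)
          (a := DHL.imageA c s t a b) (b := DHL.imageB c s t a b) (DHL.imageB_eq_zero hD) n
          fun k hk => by
            rw [← hR, ← Function.iterate_succ_apply]
            exact hn (k + 1) (by omega)
      have hdn' : DifferentiableAt ℂ (DHL.R^[n]) (DHL.R (DHL.pt c s t)) := by rwa [hR]
      rw [Function.iterate_succ, fderiv_comp _ hdn' hdR, ContinuousLinearMap.comp_apply, hfd, hR,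
        hfn, DHL.euclNorm_tangent _ _ _ hcs, DHL.euclNorm_tangent _ _ _ hcs'']
      have h4 : (4 : ℝ) ^ n * (a ^ 2 / 8) ≤ a'' ^ 2 :=
        (mul_le_mul_of_nonneg_left hl (by positivity)).trans
          (hln.trans (DHL.lorentz_le_sq h0'' h1'' _ _))
      apply Real.le_sqrt_of_sq_le
      rw [mul_pow, Real.sq_sqrt (by positivity)]
      have e : (1 / 8 * (2 : ℝ) ^ (n + 1)) ^ 2 = 4 ^ n / 16 := by
        rw [mul_pow, ← pow_mul, mul_comm (n + 1) 2, pow_mul]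
        norm_num [pow_succ]
        ring
      rw [e]
      nlinarith [sq_nonneg b'', mul_le_mul_of_nonneg_left hba (by positivity : (0 : ℝ) ≤ 4 ^ n)]
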